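/- Let $\mathcal X$ be a finite-dimensional complex Euclidean space and let $P,Q$ be positive semidefinite operators on $\mathcal X$. Write $\|A\|_1=\operatorname{tr}\sqrt{A^*A}$, let \[ D(P\|Q)=\begin{cases}\operatorname{tr}\bigl(P\ln P-P\ln Q\bigr) & \text{if }\operatorname{im}P\subseteq\operatorname{im}Q,\\ +\infty & \text{otherwise,}\end{cases} \] (natural logarithm, with the usual convention that $\ln$ is set to $0$ on the kernel), let $\Pi$ be the orthogonal projector onto the positive eigenspace of $P-Q$ (the span of the eigenvectors with strictly positive eigenvalue), and put \[ C_Q^{-1}=\max\{\operatorname{tr}\Pi P,\ \operatorname{tr}\Pi Q,\ \operatorname{tr}P-\operatorname{tr}\Pi P,\ \operatorname{tr}Q-\operatorname{tr}\Pi Q\},\qquad \widetilde C_Q^{-1}=\max\{\operatorname{tr}P,\operatorname{tr}Q\} \] (if $P=Q=0$, where both maxima vanish, put $C_Q=\widetilde C_Q=0$). Then \[ \tfrac14\|P-Q\|_1^2\le \max\{\operatorname{tr}P,\operatorname{tr}Q\}\,\bigl[D(P\|Q)-\operatorname{tr}(P-Q)\bigr] \] and \[ D(P\|Q)-\operatorname{tr}P+\operatorname{tr}Q\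 \ge\ \frac{C_Q}{4}\|P-Q\|_1^2\ \ge\ \frac{\widetilde C_Q}{4}\|P-Q\|_1^2 . \] Moreover, the first of the last two inequalities is sharp: if $\dim\mathcal X\ge 2$, then for every $c>1$ there are positive semidefinite operators $P\ne Q$ on $\mathcal X$, which can be taken of trace $1$, with \[ D(P\|Q)-\operatorname{tr}P+\operatorname{tr}Q< c\cdot\frac{C_Q}{4}\|P-Q\|_1^2 . \] -/

import Mathlib

open Matrix
open scoped ComplexOrder

namespace GenPinsker

variable {n : Type*} [Fintype n] [DecidableEq n]

/-- The trace norm `‖A‖₁ = tr √(A* A)`. The trace of the positive semidefinite matrix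
`√(A* A)` is real, so nothing is lost by taking its real part. -/
noncomputable def traceNorm (A : Matrix n n ℂ) : ℝ :=
  (cfc Real.sqrt (Aᴴ * A)).trace.re

open Classical in
/-- The quantum relative entropy of positive semidefinite matrices:
`D(P‖Q) = tr (P ln P - P ln Q)` if `im P ⊆ im Q`, and `+∞` otherwise. The logarithm is the
natural one, applied through the spectral decomposition, with `ln 0` read as `0`; this gives
`0 ln 0 = 0`, and `ln Q` on `ker Q` does not contribute when `im P ⊆ im Q`. The trace is real. -/
noncomputable def relEntropy (P Q : Matrix n n ℂ) : EReal :=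
  if LinearMap.range P.mulVecLin ≤ LinearMap.range Q.mulVecLin then
    (((P * cfc Real.log P - P * cfc Real.log Q).trace.re : ℝ) : EReal)
  else ⊤

/-- The orthogonal projector onto the span of the eigenvectors of the Hermitian matrix `A`
with (strictly) positive eigenvalue, i.e. the spectral projector of `A` for `(0, ∞)`. -/
noncomputable def posProj (A : Matrix n n ℂ) : Matrix n n ℂ :=
  cfc (Set.indicator (Set.Ioi (0 : ℝ)) (fun _ => (1 : ℝ))) A

/-- `C_Q`, where `C_Q⁻¹` is the maximum of the traces of `P` and `Q` in the two blocks cut out by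
`Π`, the projector onto the positive eigenspace of `P - Q`.
For `P = Q = 0` this is `0⁻¹ = 0`; the bounds then read `0 ≥ 0 ≥ 0`. -/
noncomputable def blockConst (P Q : Matrix n n ℂ) : ℝ :=
  (max (max (posProj (P - Q) * P).trace.re (posProj (P - Q) * Q).trace.re)
    (max (P.trace.re - (posProj (P - Q) * P).trace.re)
      (Q.trace.re - (posProj (P - Q) * Q).trace.re)))⁻¹

/-- `C̃_Q = (max {tr P, tr Q})⁻¹`. -/
noncomputable def traceConst (P Q : Matrix n n ℂ) : ℝ :=
  (max P.trace.re Q.trace.re)⁻¹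

end GenPinsker

/-!
The route is a scalar inequality followed by a quadratic optimisation.

For `p ≥ 0` and `q > 0` one has `p ln (p / q) - p + q ≥ 3 (p - q)² / (2 (p + 2 q))`; completing the
square in a free complex parameter `x` turns this into the family of bounds
`|w|² (p ln p - p ln q - p + q) ≥ (p - q) Re (w x̄) - (p / 6 + q / 3) |x|²`
(`re_mul_sub_le_entropy_term`). Take `p`, `q` to be eigenvalues of `P`, `Q`, take `w` to be the
overlap of the corresponding eigenvectors, and `x` the entry of a Hermitian matrix `X` between
them. Summing over all pairs of eigenvalues gives, when `im P ⊆ im Q`,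
`D(P‖Q) - tr P + tr Q ≥ tr X (P - Q) - tr P X² / 6 - tr Q X² / 3`
for every Hermitian `X` (`variational_le_relEntropy`). No operator convexity, data processing or
Golden–Thompson inequality is involved.

Let `Π` be the positive projector of `P - Q`, put `a = tr Π (P - Q)` and `b = - tr (1 - Π) (P - Q)`,
so that `‖P - Q‖₁ = a + b` (`traceNorm_eq_trace`), and let `M = C_Q⁻¹`. The choice
`X = (a / M) Π - (b / M) (1 - Π)` yields the lower bound `(a² + b²) / (2 M) ≥ (a + b)² / (4 M)`,
because the four block traces are at most `M`. The bound in terms of `max {tr P, tr Q}` is weaker,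
since `tr Π P ≤ tr P` and so on.

For sharpness, two commuting states `diag ((1 ± x) / 2)` and `diag (1 / 2, 1 / 2)` suffice: as
`x → 0` the relative entropy is `x² / 2 + O(x³)`, while `C_Q ‖P - Q‖₁² / 4 = x² / (2 (1 + x))`.
-/

namespace GenPinsker

/-! ### The scalar inequality -/

/-- The two sides agree to third order at `x = 1`: the derivative of their difference is
`(x - 1)³ / (x² (x + 2)²)`, so the difference decreases on `(0, 1]` and increases on `[1, ∞)`. -/
theorem rational_le_log {x : ℝ} (hx : 0 < x) :
    (5 * x ^ 2 - 4 * x - 1) / (2 * x ^ 2 + 4 * x) ≤ Real.log x := by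
  set h : ℝ → ℝ := fun y => Real.log y - (5 * y ^ 2 - 4 * y - 1) / (2 * y ^ 2 + 4 * y) with hh
  have hd : ∀ y : ℝ, 0 < y → HasDerivAt h ((y - 1) ^ 3 / (y ^ 2 * (y + 2) ^ 2)) y := by
    intro y hy
    have h1 : HasDerivAt (fun y : ℝ => 5 * y ^ 2 - 4 * y - 1) (10 * y - 4) y := by
      refine ((((hasDerivAt_pow 2 y).const_mul 5).sub
        ((hasDerivAt_id y).const_mul 4)).sub_const 1).congr_deriv ?_
      norm_num
      ring
    have h2 : HasDerivAt (fun y : ℝ => 2 * y ^ 2 + 4 * y) (4 * y + 4) y := by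
      refine (((hasDerivAt_pow 2 y).const_mul 2).add
        ((hasDerivAt_id y).const_mul 4)).congr_deriv ?_
      norm_num
      ring
    have hne : 2 * y ^ 2 + 4 * y ≠ 0 := by positivity
    refine ((Real.hasDerivAt_log hy.ne').sub (h1.div h2 hne)).congr_deriv ?_
    have : y + 2 ≠ 0 := by positivity
    have : 2 * y ^ 2 + 4 * y = 2 * y * (y + 2) := by ring
    rw [this]
    field_simp
    ring
  have h1 : h 1 = 0 := by simp [hh]; norm_num
  suffices 0 ≤ h x by simpa [hh] using this
  rw [← h1]
  rcases le_total x 1 with hx1 | hx1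
  · have hanti : AntitoneOn h (Set.Icc x 1) := by
      refine antitoneOn_of_deriv_nonpos (convex_Icc x 1)
        (fun y hy => (hd y (hx.trans_le hy.1)).continuousAt.continuousWithinAt) ?_ ?_
      · intro y hy
        rw [interior_Icc] at hy
        exact (hd y (hx.trans hy.1)).differentiableAt.differentiableWithinAt
      · intro y hy
        rw [interior_Icc] at hy
        rw [(hd y (hx.trans hy.1)).deriv]
        refine div_nonpos_of_nonpos_of_nonneg ?_ (by positivity)
        exact (Odd.pow_nonpos (by decide) (by linarith [hy.2]))
    exact hanti ⟨le_rfl, hx1⟩ ⟨hx1, le_rfl⟩ hx1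
  · have hmono : MonotoneOn h (Set.Icc 1 x) := by
      refine monotoneOn_of_deriv_nonneg (convex_Icc 1 x)
        (fun y hy => (hd y (one_pos.trans_le hy.1)).continuousAt.continuousWithinAt) ?_ ?_
      · intro y hy
        rw [interior_Icc] at hy
        exact (hd y (one_pos.trans hy.1)).differentiableAt.differentiableWithinAt
      · intro y hy
        rw [interior_Icc] at hy
        rw [(hd y (one_pos.trans hy.1)).deriv]
        have : 0 ≤ y - 1 := by linarith [hy.1]
        positivity
    exact hmono ⟨le_rfl, hx1⟩ ⟨hx1, le_rfl⟩ hx1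

theorem three_mul_sq_le_entropy_term {p q : ℝ} (hp : 0 ≤ p) (hq : 0 < q) :
    3 * (p - q) ^ 2 / (2 * (p + 2 * q)) ≤ p * Real.log p - p * Real.log q - p + q := by
  rcases hp.eq_or_lt with rfl | hp
  · rw [div_le_iff₀ (by positivity)]
    simp
    nlinarith
  · have h := mul_le_mul_of_nonneg_left (rational_le_log (div_pos hp hq)) hp.le
    rw [Real.log_div hp.ne' hq.ne'] at h
    have e : p * ((5 * (p / q) ^ 2 - 4 * (p / q) - 1) / (2 * (p / q) ^ 2 + 4 * (p / q)))
        = 3 * (p - q) ^ 2 / (2 * (p + 2 * q)) + p - q := by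
      field_simp
      ring
    rw [e] at h
    linarith

/-- When `q = 0`, the hypothesis `h` leaves only `p = 0` or `w = 0`, so the value `log 0 = 0` does
no harm. -/
theorem re_mul_sub_le_entropy_term {p q : ℝ} (hp : 0 ≤ p) (hq : 0 ≤ q) (w x : ℂ)
    (h : q = 0 → p = 0 ∨ w = 0) :
    (p - q) * (w * star x).re - (p / 6 + q / 3) * Complex.normSq x
      ≤ Complex.normSq w * (p * Real.log p - p * Real.log q - p + q) := by
  have hx := Complex.normSq_nonneg x
  rcases hq.eq_or_lt with rfl | hq
  · rcases h rfl with rfl | rfl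
    · simp
    · simp
      positivity
  · refine le_trans ?_ (mul_le_mul_of_nonneg_left (three_mul_sq_le_entropy_term hp hq)
      (Complex.normSq_nonneg w))
    rw [mul_div_assoc', le_div_iff₀ (by positivity)]
    simp only [Complex.normSq_apply, Complex.mul_re, Complex.star_def, Complex.conj_re,
      Complex.conj_im]
    -- The gap is a third of the sum of these two squares, which come from the real and the
    -- imaginary parts.
    nlinarith [sq_nonneg (3 * (p - q) * w.re - (p + 2 * q) * x.re),
      sq_nonneg (3 * (p - q) * w.im - (p + 2 * q) * x.im)]

/-! ### The variational bound for the relative entropy -/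

section

variable {n : Type*} [Fintype n] [DecidableEq n]

theorem cfc_eq_conj_diagonal {A : Matrix n n ℂ} (hA : A.IsHermitian) (f : ℝ → ℝ) :
    cfc f A = (hA.eigenvectorUnitary : Matrix n n ℂ) *
      diagonal (fun i => (f (hA.eigenvalues i) : ℂ)) * (hA.eigenvectorUnitary : Matrix n n ℂ)ᴴ := by
  rw [hA.cfc_eq, Matrix.IsHermitian.cfc, Unitary.conjStarAlgAut_apply]
  rfl

theorem trace_conj_diagonal_mul (U V Y Z : Matrix n n ℂ) (a b : n → ℂ) :
    ((U * diagonal a * Uᴴ) * Y * (V * diagonal b * Vᴴ) * Z).trace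
      = ∑ i, ∑ j, a i * b j * ((Uᴴ * Y * V) i j * (Vᴴ * Z * U) j i) := by
  have : ((U * diagonal a * Uᴴ) * Y * (V * diagonal b * Vᴴ) * Z).trace
      = ((diagonal a * (Uᴴ * Y * V)) * (diagonal b * (Vᴴ * Z * U))).trace := by
    simp only [Matrix.mul_assoc]
    rw [Matrix.trace_mul_comm U]
    simp only [Matrix.mul_assoc]
  rw [this]
  simp only [Matrix.trace, Matrix.diag_apply, Matrix.mul_apply (M := diagonal a * _),
    Matrix.diagonal_mul]
  exact Finset.sum_congr rfl fun i _ => Finset.sum_congr rfl fun j _ => by ring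

theorem exists_eq_mul_of_range_le {P Q : Matrix n n ℂ}
    (h : LinearMap.range P.mulVecLin ≤ LinearMap.range Q.mulVecLin) :
    ∃ B : Matrix n n ℂ, P = Q * B := by
  have : ∀ j, ∃ v, Q *ᵥ v = P *ᵥ Pi.single j 1 := fun j => by
    obtain ⟨v, hv⟩ := h ⟨Pi.single j 1, rfl⟩
    exact ⟨v, hv⟩
  choose v hv using this
  refine ⟨(Matrix.of v)ᵀ, ?_⟩
  ext i j
  have := congrFun (hv j) i
  simp only [Matrix.mulVec_single_one, Matrix.col_apply] at this
  rw [← this]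
  rfl

/-- If `im P ⊆ im Q`, every eigenvector of `Q` with eigenvalue `0` is orthogonal to every
eigenvector of `P` with nonzero eigenvalue. -/
theorem eigenvalue_eq_zero_or_overlap_eq_zero {P Q : Matrix n n ℂ} (hP : P.IsHermitian)
    (hQ : Q.IsHermitian) (h : LinearMap.range P.mulVecLin ≤ LinearMap.range Q.mulVecLin) (i j : n)
    (hj : hQ.eigenvalues j = 0) :
    hP.eigenvalues i = 0 ∨
      ((hP.eigenvectorUnitary : Matrix n n ℂ)ᴴ * (hQ.eigenvectorUnitary : Matrix n n ℂ)) i j = 0 := by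
  obtain ⟨B, hB⟩ := exists_eq_mul_of_range_le h
  set U := (hP.eigenvectorUnitary : Matrix n n ℂ) with hU
  set V := (hQ.eigenvectorUnitary : Matrix n n ℂ) with hV
  have hUU : Uᴴ * U = 1 := Unitary.coe_star_mul_self hP.eigenvectorUnitary
  have hVV : Vᴴ * V = 1 := Unitary.coe_star_mul_self hQ.eigenvectorUnitary
  have eP : P = U * diagonal (fun i => (hP.eigenvalues i : ℂ)) * Uᴴ := by
    simpa [cfc_id' ℝ P hP.isSelfAdjoint] using cfc_eq_conj_diagonal hP (fun x => x)
  have eQ : Q = V * diagonal (fun i => (hQ.eigenvalues i : ℂ)) * Vᴴ := by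
    simpa [cfc_id' ℝ Q hQ.isSelfAdjoint] using cfc_eq_conj_diagonal hQ (fun x => x)
  have e1 : Vᴴ * P * U = (Vᴴ * U) * diagonal (fun i => (hP.eigenvalues i : ℂ)) := by
    conv_lhs => rw [eP]
    simp only [Matrix.mul_assoc, hUU, Matrix.mul_one]
  have e2 : Vᴴ * P * U = diagonal (fun i => (hQ.eigenvalues i : ℂ)) * (Vᴴ * B * U) := by
    rw [hB]
    conv_lhs => rw [eQ]
    simp only [← Matrix.mul_assoc, hVV, Matrix.one_mul]
  have e3 := congrFun (congrFun (e1.symm.trans e2) j) i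
  rw [Matrix.mul_diagonal, Matrix.diagonal_mul, hj] at e3
  simp only [Complex.ofReal_zero, zero_mul, mul_eq_zero, Complex.ofReal_eq_zero] at e3
  rcases e3 with e3 | e3
  · right
    have : (Uᴴ * V) i j = star ((Vᴴ * U) j i) := by
      rw [← Matrix.conjTranspose_apply, Matrix.conjTranspose_mul, Matrix.conjTranspose_conjTranspose]
    rw [this, e3, star_zero]
  · exact Or.inl e3

/-- A variational lower bound for the relative entropy, by summing the scalar inequality over all
pairs of eigenvalues of `P` and `Q`. -/
theorem variational_le_relEntropy {P Q X : Matrix n n ℂ} (hP : P.PosSemidef) (hQ : Q.PosSemidef)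
    (hX : X.IsHermitian) (h : LinearMap.range P.mulVecLin ≤ LinearMap.range Q.mulVecLin) :
    (P * X).trace.re - (Q * X).trace.re - ((P * X * X).trace.re / 6 + (Q * X * X).trace.re / 3)
      ≤ (P * cfc Real.log P - P * cfc Real.log Q).trace.re - P.trace.re + Q.trace.re := by
  set U := (hP.1.eigenvectorUnitary : Matrix n n ℂ) with hU
  set V := (hQ.1.eigenvectorUnitary : Matrix n n ℂ) with hV
  set p := hP.1.eigenvalues with hp
  set q := hQ.1.eigenvalues with hq
  have hUU : Uᴴ * U = 1 := Unitary.coe_star_mul_self hP.1.eigenvectorUnitary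
  have hUU' : U * Uᴴ = 1 := Unitary.coe_mul_star_self hP.1.eigenvectorUnitary
  have hVV' : V * Vᴴ = 1 := Unitary.coe_mul_star_self hQ.1.eigenvectorUnitary
  have eP : P = U * diagonal (fun i => (p i : ℂ)) * Uᴴ := by
    simpa [cfc_id' ℝ P hP.1.isSelfAdjoint] using cfc_eq_conj_diagonal hP.1 (fun x => x)
  have eQ : Q = V * diagonal (fun i => (q i : ℂ)) * Vᴴ := by
    simpa [cfc_id' ℝ Q hQ.1.isSelfAdjoint] using cfc_eq_conj_diagonal hQ.1 (fun x => x)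
  have eL := cfc_eq_conj_diagonal hQ.1 Real.log
  have ePL : P * cfc Real.log P
      = U * diagonal (fun i => ((p i * Real.log (p i) : ℝ) : ℂ)) * Uᴴ := by
    rw [show P * cfc Real.log P = (U * diagonal (fun i => (p i : ℂ)) * Uᴴ) * cfc Real.log P from
      congrArg (· * cfc Real.log P) eP, cfc_eq_conj_diagonal hP.1 Real.log]
    rw [show U * diagonal (fun i => (p i : ℂ)) * Uᴴ *
      (U * diagonal (fun i => ((Real.log (p i) : ℝ) : ℂ)) * Uᴴ) =
      U * (diagonal (fun i => (p i : ℂ)) * (Uᴴ * U) *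
        diagonal (fun i => ((Real.log (p i) : ℝ) : ℂ))) * Uᴴ by simp only [Matrix.mul_assoc]]
    rw [hUU, Matrix.mul_one, Matrix.diagonal_mul_diagonal]
    simp
  have e1U : (1 : Matrix n n ℂ) = U * diagonal (fun _ => 1) * Uᴴ := by simp [hUU']
  have e1V : (1 : Matrix n n ℂ) = V * diagonal (fun _ => 1) * Vᴴ := by simp [hVV']
  set W := Uᴴ * V with hW
  set Y := Uᴴ * X * V with hY
  have hW' : ∀ i j, (Vᴴ * U) j i = star (W i j) := fun i j => by
    rw [← Matrix.conjTranspose_apply, hW, Matrix.conjTranspose_mul,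
      Matrix.conjTranspose_conjTranspose]
  have hY' : ∀ i j, (Vᴴ * X * U) j i = star (Y i j) := fun i j => by
    rw [← Matrix.conjTranspose_apply, hY, Matrix.conjTranspose_mul, Matrix.conjTranspose_mul,
      Matrix.conjTranspose_conjTranspose, hX.eq, Matrix.mul_assoc]
  have hsq : ∀ z : ℂ, z * star z = (Complex.normSq z : ℂ) := fun z => Complex.mul_conj z
  have t1 : (P * cfc Real.log P).trace.re
      = ∑ i, ∑ j, Complex.normSq (W i j) * (p i * Real.log (p i)) := by
    have := trace_conj_diagonal_mul U V 1 1 (fun i => ((p i * Real.log (p i) : ℝ) : ℂ)) (fun _ => 1)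
    rw [← ePL, ← e1V] at this
    simp only [Matrix.mul_one] at this
    rw [this]
    simp only [hW', ← hW, hsq, Complex.re_sum, mul_one, ← Complex.ofReal_mul, Complex.ofReal_re]
    exact Finset.sum_congr rfl fun i _ => Finset.sum_congr rfl fun j _ => by ring
  have t2 : (P * cfc Real.log Q).trace.re
      = ∑ i, ∑ j, Complex.normSq (W i j) * (p i * Real.log (q j)) := by
    have := trace_conj_diagonal_mul U V 1 1 (fun i => (p i : ℂ)) (fun j => (Real.log (q j) : ℂ))
    rw [← eP, ← eL] at this
    simp only [Matrix.mul_one] at this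
    rw [this]
    simp only [hW', ← hW, hsq, Complex.re_sum, ← Complex.ofReal_mul, Complex.ofReal_re]
    exact Finset.sum_congr rfl fun i _ => Finset.sum_congr rfl fun j _ => by ring
  have t3 : P.trace.re = ∑ i, ∑ j, Complex.normSq (W i j) * p i := by
    have := trace_conj_diagonal_mul U V 1 1 (fun i => (p i : ℂ)) (fun _ => 1)
    rw [← eP, ← e1V] at this
    simp only [Matrix.mul_one] at this
    rw [this]
    simp only [hW', ← hW, hsq, Complex.re_sum, mul_one, ← Complex.ofReal_mul, Complex.ofReal_re]
    exact Finset.sum_congr rfl fun i _ => Finset.sum_congr rfl fun j _ => by ring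
  have t4 : Q.trace.re = ∑ i, ∑ j, Complex.normSq (W i j) * q j := by
    have := trace_conj_diagonal_mul U V 1 1 (fun _ => 1) (fun j => (q j : ℂ))
    rw [← eQ, ← e1U] at this
    simp only [Matrix.mul_one, Matrix.one_mul] at this
    rw [this]
    simp only [hW', ← hW, hsq, Complex.re_sum, one_mul, ← Complex.ofReal_mul, Complex.ofReal_re]
    exact Finset.sum_congr rfl fun i _ => Finset.sum_congr rfl fun j _ => by ring
  have t5 : (P * X).trace.re = ∑ i, ∑ j, p i * (W i j * star (Y i j)).re := by
    have := trace_conj_diagonal_mul U V 1 X (fun i => (p i : ℂ)) (fun _ => 1)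
    rw [← eP, ← e1V] at this
    simp only [Matrix.mul_one] at this
    rw [this]
    simp only [hY', ← hW, Complex.re_sum, mul_one, Complex.re_ofReal_mul]
  have t6 : (Q * X).trace.re = ∑ i, ∑ j, q j * (W i j * star (Y i j)).re := by
    have := trace_conj_diagonal_mul U V 1 X (fun _ => 1) (fun j => (q j : ℂ))
    rw [← eQ, ← e1U] at this
    simp only [Matrix.mul_one, Matrix.one_mul] at this
    rw [this]
    simp only [hY', ← hW, Complex.re_sum, one_mul, Complex.re_ofReal_mul]
  have t7 : (P * X * X).trace.re = ∑ i, ∑ j, p i * Complex.normSq (Y i j) := by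
    have := trace_conj_diagonal_mul U V X X (fun i => (p i : ℂ)) (fun _ => 1)
    rw [← eP, ← e1V] at this
    simp only [Matrix.mul_one] at this
    rw [this]
    simp only [hY', ← hY, hsq, Complex.re_sum, mul_one, ← Complex.ofReal_mul, Complex.ofReal_re]
  have t8 : (Q * X * X).trace.re = ∑ i, ∑ j, q j * Complex.normSq (Y i j) := by
    have := trace_conj_diagonal_mul U V X X (fun _ => 1) (fun j => (q j : ℂ))
    rw [← eQ, ← e1U, Matrix.one_mul, Matrix.mul_assoc, Matrix.trace_mul_comm] at this
    rw [this]
    simp only [hY', ← hY, hsq, Complex.re_sum, one_mul, ← Complex.ofReal_mul, Complex.ofReal_re]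
  rw [Matrix.trace_sub, Complex.sub_re, t1, t2, t3, t4, t5, t6, t7, t8]
  simp only [Finset.sum_div, ← Finset.sum_add_distrib, ← Finset.sum_sub_distrib]
  refine Finset.sum_le_sum fun i _ => Finset.sum_le_sum fun j _ => ?_
  have := re_mul_sub_le_entropy_term (hP.eigenvalues_nonneg i) (hQ.eigenvalues_nonneg j)
    (W i j) (Y i j) (eigenvalue_eq_zero_or_overlap_eq_zero hP.1 hQ.1 h i j)
  simp only [← hp, ← hq] at this
  linarith

/-! ### The positive projector and the trace norm -/

theorem continuousOn_spectrum (A : Matrix n n ℂ) (f : ℝ → ℝ) : ContinuousOn f (spectrum ℝ A) :=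
  Matrix.finite_real_spectrum.continuousOn f

theorem isHermitian_posProj (A : Matrix n n ℂ) : (posProj A).IsHermitian :=
  cfc_predicate (R := ℝ) (p := IsSelfAdjoint) _ A

theorem posProj_mul_self (A : Matrix n n ℂ) : posProj A * posProj A = posProj A := by
  rw [posProj, ← cfc_mul _ _ A (continuousOn_spectrum A _) (continuousOn_spectrum A _)]
  congr 1
  ext x
  by_cases hx : x ∈ Set.Ioi (0 : ℝ) <;> simp [hx]

/-- `|A| = A Π - A (1 - Π)` for Hermitian `A` with positive projector `Π`. -/
theorem traceNorm_eq_trace {A : Matrix n n ℂ} (hA : A.IsHermitian) :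
    traceNorm A = 2 * (A * posProj A).trace.re - A.trace.re := by
  have hs : IsSelfAdjoint A := hA.isSelfAdjoint
  have h1 : cfc Real.sqrt (Aᴴ * A) = cfc (fun x : ℝ => |x|) A := by
    have : Aᴴ * A = cfc (fun x : ℝ => x ^ 2) A := by
      rw [cfc_pow_id (R := ℝ) A 2 hs, hA.eq, sq]
    rw [this, ← cfc_comp' Real.sqrt (fun x : ℝ => x ^ 2) A]
    simp only [Real.sqrt_sq_eq_abs]
  have h2 : cfc (fun x : ℝ => |x|) A = A * posProj A + A * posProj A - A := by
    have e : A * posProj A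
        = cfc (fun x : ℝ => x * Set.indicator (Set.Ioi (0 : ℝ)) (fun _ => (1 : ℝ)) x) A := by
      rw [cfc_mul (fun x : ℝ => x) _ A (continuousOn_spectrum A _) (continuousOn_spectrum A _),
        cfc_id' ℝ A hs, posProj]
    rw [e, ← cfc_add A _ _ (continuousOn_spectrum A _) (continuousOn_spectrum A _)]
    conv_rhs => arg 2; rw [← cfc_id' ℝ A hs]
    rw [← cfc_sub _ _ A (continuousOn_spectrum A _) (continuousOn_spectrum A _)]
    congr 1
    ext x
    by_cases hx : 0 < x
    · simp [Set.mem_Ioi.2 hx, abs_of_pos hx]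
    · simp [Set.mem_Ioi, hx, abs_of_nonpos (not_lt.1 hx)]
  rw [traceNorm, h1, h2]
  simp only [Matrix.trace_sub, Matrix.trace_add, Complex.sub_re, Complex.add_re]
  ring

omit [DecidableEq n] in
theorem trace_mul_nonneg_of_projection {E P : Matrix n n ℂ} (hE : E.IsHermitian) (hEE : E * E = E)
    (hP : P.PosSemidef) : 0 ≤ (E * P).trace.re := by
  have h := (hP.mul_mul_conjTranspose_same E).trace_nonneg
  rw [hE.eq, Matrix.trace_mul_comm, ← Matrix.mul_assoc, hEE] at h
  exact (Complex.le_def.1 h).1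

theorem trace_posProj_mul_nonneg (A : Matrix n n ℂ) {P : Matrix n n ℂ} (hP : P.PosSemidef) :
    0 ≤ (posProj A * P).trace.re :=
  trace_mul_nonneg_of_projection (isHermitian_posProj A) (posProj_mul_self A) hP

theorem trace_posProj_mul_le (A : Matrix n n ℂ) {P : Matrix n n ℂ} (hP : P.PosSemidef) :
    (posProj A * P).trace.re ≤ P.trace.re := by
  have h := trace_mul_nonneg_of_projection (E := 1 - posProj A)
    (Matrix.isHermitian_one.sub (isHermitian_posProj A))
    (by simp [mul_sub, sub_mul, posProj_mul_self]) hP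
  rw [sub_mul, Matrix.one_mul, Matrix.trace_sub, Complex.sub_re] at h
  linarith

/-! ### The lower bounds -/

theorem blockConst_bound {P Q : Matrix n n ℂ} (hP : P.PosSemidef) (hQ : Q.PosSemidef)
    (h : LinearMap.range P.mulVecLin ≤ LinearMap.range Q.mulVecLin) :
    blockConst P Q / 4 * traceNorm (P - Q) ^ 2
      ≤ (P * cfc Real.log P - P * cfc Real.log Q).trace.re - P.trace.re + Q.trace.re := by
  rw [traceNorm_eq_trace (hP.1.sub hQ.1), blockConst,
    Matrix.trace_mul_comm (P - Q), Matrix.mul_sub]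
  set E := posProj (P - Q) with hE
  have hEE : E * E = E := posProj_mul_self _
  have hEh : E.IsHermitian := isHermitian_posProj _
  have hP0 := trace_posProj_mul_nonneg (P - Q) hP
  have hQ0 := trace_posProj_mul_nonneg (P - Q) hQ
  rw [← hE] at hP0 hQ0
  simp only [Matrix.trace_sub, Complex.sub_re]
  set p₁ := (E * P).trace.re with hp₁
  set q₁ := (E * Q).trace.re with hq₁
  set M := max (max p₁ q₁) (max (P.trace.re - p₁) (Q.trace.re - q₁)) with hM
  have m1 : p₁ ≤ M := (le_max_left _ _).trans (le_max_left _ _)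
  have m2 : q₁ ≤ M := (le_max_right _ _).trans (le_max_left _ _)
  have m3 : P.trace.re - p₁ ≤ M := (le_max_left _ _).trans (le_max_right _ _)
  have m4 : Q.trace.re - q₁ ≤ M := (le_max_right _ _).trans (le_max_right _ _)
  have hM0 : 0 ≤ M := hP0.trans m1
  -- The maximiser `X = y E + z (1 - E)` of the variational bound, with `M` in place of the four
  -- block traces; for `M = 0` it is `0`, which gives the nonnegativity of the right-hand side.
  set y : ℝ := (p₁ - q₁) / M with hy
  set z : ℝ := ((P.trace.re - p₁) - (Q.trace.re - q₁)) / M with hz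
  have key := variational_le_relEntropy (X := (y : ℂ) • E + (z : ℂ) • (1 - E)) hP hQ
    (by
      refine Matrix.IsHermitian.add ?_ ?_
      · rw [Matrix.IsHermitian, Matrix.conjTranspose_smul, hEh.eq]; simp
      · rw [Matrix.IsHermitian, Matrix.conjTranspose_smul, Matrix.conjTranspose_sub, hEh.eq]
        simp) h
  have tX : ∀ R : Matrix n n ℂ, (R * ((y : ℂ) • E + (z : ℂ) • (1 - E))).trace.re
      = y * (E * R).trace.re + z * (R.trace.re - (E * R).trace.re) := fun R => by
    rw [Matrix.trace_mul_comm E R]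
    simp [mul_add, mul_sub, Matrix.trace_add, Matrix.trace_sub]
  have tXX : ∀ R : Matrix n n ℂ, (R * ((y : ℂ) • E + (z : ℂ) • (1 - E)) *
        ((y : ℂ) • E + (z : ℂ) • (1 - E))).trace.re
      = y ^ 2 * (E * R).trace.re + z ^ 2 * (R.trace.re - (E * R).trace.re) := fun R => by
    have : ((y : ℂ) • E + (z : ℂ) • (1 - E)) * ((y : ℂ) • E + (z : ℂ) • (1 - E))
        = ((y ^ 2 : ℝ) : ℂ) • E + ((z ^ 2 : ℝ) : ℂ) • (1 - E) := by
      simp only [mul_add, add_mul, mul_sub, sub_mul, smul_mul_smul_comm, hEE, Matrix.one_mul,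
        Matrix.mul_one, sub_self, smul_zero, add_zero, zero_add, sub_zero]
      push_cast
      rw [sq, sq]
    rw [Matrix.mul_assoc, this, Matrix.trace_mul_comm E R]
    simp [mul_add, mul_sub, Matrix.trace_add, Matrix.trace_sub, -Complex.ofReal_pow]
  rw [tX, tX, tXX, tXX, ← hp₁, ← hq₁, Matrix.trace_sub, Complex.sub_re] at key
  refine le_trans ?_ key
  rcases hM0.eq_or_lt with hM' | hMpos
  · simp [hy, hz, ← hM']
  · have ha : p₁ - q₁ = y * M := by rw [hy]; field_simp
    have hb : (P.trace.re - p₁) - (Q.trace.re - q₁) = z * M := by rw [hz]; field_simp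
    have e : M⁻¹ / 4 * (2 * (p₁ - q₁) - (P.trace.re - Q.trace.re)) ^ 2 = M * (y - z) ^ 2 / 4 := by
      rw [show 2 * (p₁ - q₁) - (P.trace.re - Q.trace.re) = (y - z) * M by linarith]
      field_simp
    rw [e]
    have i1 := mul_le_mul_of_nonneg_left m1 (sq_nonneg y)
    have i2 := mul_le_mul_of_nonneg_left m2 (sq_nonneg y)
    have i3 := mul_le_mul_of_nonneg_left m3 (sq_nonneg z)
    have i4 := mul_le_mul_of_nonneg_left m4 (sq_nonneg z)
    have l1 : y * p₁ - y * q₁ = y ^ 2 * M := by rw [← mul_sub, ha]; ring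
    have l2 : z * (P.trace.re - p₁) - z * (Q.trace.re - q₁) = z ^ 2 * M := by
      rw [← mul_sub, hb]; ring
    have i5 := mul_nonneg hMpos.le (sq_nonneg (y + z))
    linarith

theorem traceConst_le_blockConst {P Q : Matrix n n ℂ} (hP : P.PosSemidef) (hQ : Q.PosSemidef) :
    traceConst P Q ≤ blockConst P Q := by
  have hP0 := trace_posProj_mul_nonneg (P - Q) hP
  have hQ0 := trace_posProj_mul_nonneg (P - Q) hQ
  have hP1 := trace_posProj_mul_le (P - Q) hP
  have hQ1 := trace_posProj_mul_le (P - Q) hQ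
  rw [traceConst, blockConst]
  set p₁ := (posProj (P - Q) * P).trace.re
  set q₁ := (posProj (P - Q) * Q).trace.re
  set M := max (max p₁ q₁) (max (P.trace.re - p₁) (Q.trace.re - q₁)) with hM
  have m1 : p₁ ≤ M := (le_max_left _ _).trans (le_max_left _ _)
  have m2 : q₁ ≤ M := (le_max_right _ _).trans (le_max_left _ _)
  have m3 : P.trace.re - p₁ ≤ M := (le_max_left _ _).trans (le_max_right _ _)
  have m4 : Q.trace.re - q₁ ≤ M := (le_max_right _ _).trans (le_max_right _ _)
  rcases (hP0.trans m1).eq_or_lt with h0 | h0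
  · -- If all four block traces vanish, then so do both traces, and both constants are `0⁻¹ = 0`.
    have e1 : P.trace.re = 0 := by linarith
    have e2 : Q.trace.re = 0 := by linarith
    rw [← h0, e1, e2, max_self]
  · refine inv_anti₀ h0 (max_le (max_le ?_ ?_) (max_le ?_ ?_))
    · exact hP1.trans (le_max_left _ _)
    · exact hQ1.trans (le_max_right _ _)
    · exact (sub_le_self _ hP0).trans (le_max_left _ _)
    · exact (sub_le_self _ hQ0).trans (le_max_right _ _)

theorem traceConst_bound_le {P Q : Matrix n n ℂ} (hP : P.PosSemidef) (hQ : Q.PosSemidef) :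
    traceConst P Q / 4 * traceNorm (P - Q) ^ 2 ≤ blockConst P Q / 4 * traceNorm (P - Q) ^ 2 := by
  have := traceConst_le_blockConst hP hQ
  gcongr

theorem blockConst_bound_ereal {P Q : Matrix n n ℂ} (hP : P.PosSemidef) (hQ : Q.PosSemidef) :
    ((blockConst P Q / 4 * traceNorm (P - Q) ^ 2 : ℝ) : EReal) ≤
      relEntropy P Q - ((P.trace.re : ℝ) : EReal) + ((Q.trace.re : ℝ) : EReal) := by
  rw [relEntropy]
  split_ifs with h
  · exact_mod_cast blockConst_bound hP hQ h
  · rw [EReal.top_sub_coe, EReal.top_add_coe]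
    exact le_top

omit [DecidableEq n] in
theorem trace_re_nonneg {P : Matrix n n ℂ} (hP : P.PosSemidef) : 0 ≤ P.trace.re :=
  (Complex.le_def.1 hP.trace_nonneg).1

omit [DecidableEq n] in
theorem eq_zero_of_trace_re_eq_zero {P : Matrix n n ℂ} (hP : P.PosSemidef)
    (h : P.trace.re = 0) : P = 0 :=
  hP.trace_eq_zero_iff.1 (Complex.ext h (Complex.le_def.1 hP.trace_nonneg).2.symm)

theorem traceNorm_sq_le {P Q : Matrix n n ℂ} (hP : P.PosSemidef) (hQ : Q.PosSemidef) :
    ((1 / 4 * traceNorm (P - Q) ^ 2 : ℝ) : EReal) ≤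
      ((max P.trace.re Q.trace.re : ℝ) : EReal) *
        (relEntropy P Q - (((P - Q).trace.re : ℝ) : EReal)) := by
  have hP0 := trace_re_nonneg hP
  have hQ0 := trace_re_nonneg hQ
  rw [relEntropy]
  split_ifs with h
  · have hb := (traceConst_bound_le hP hQ).trans (blockConst_bound hP hQ h)
    rw [traceConst] at hb
    rw [← EReal.coe_sub, ← EReal.coe_mul, EReal.coe_le_coe_iff, Matrix.trace_sub P Q,
      Complex.sub_re]
    rcases (hP0.trans (le_max_left _ Q.trace.re)).eq_or_lt with h0 | h0
    · have e1 : P = 0 := eq_zero_of_trace_re_eq_zero hP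
        (le_antisymm ((le_max_left _ _).trans h0.ge) hP0)
      have e2 : Q = 0 := eq_zero_of_trace_re_eq_zero hQ
        (le_antisymm ((le_max_right _ _).trans h0.ge) hQ0)
      subst e1 e2
      simp [traceNorm]
    · have := mul_le_mul_of_nonneg_left hb h0.le
      have e : max P.trace.re Q.trace.re * ((max P.trace.re Q.trace.re)⁻¹ / 4 *
          traceNorm (P - Q) ^ 2) = 1 / 4 * traceNorm (P - Q) ^ 2 := by
        field_simp
      rw [e] at this
      linarith
  · have hpos : 0 < max P.trace.re Q.trace.re := by
      refine lt_max_of_lt_left (lt_of_le_of_ne hP0 fun h0 => h ?_)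
      rw [eq_zero_of_trace_re_eq_zero hP h0.symm]
      simp
    rw [EReal.top_sub_coe, EReal.coe_mul_top_of_pos hpos]
    exact le_top

/-! ### Sharpness -/

/-- Both sides are computed by a polynomial interpolating `f` on the spectrum and the diagonal. -/
theorem cfc_diagonal (f : ℝ → ℝ) (d : n → ℝ) :
    cfc f (diagonal (fun i => (d i : ℂ))) = diagonal (fun i => (f (d i) : ℂ)) := by
  set A : Matrix n n ℂ := diagonal (fun i => (d i : ℂ)) with hA
  have hs : IsSelfAdjoint A := by
    rw [IsSelfAdjoint, Matrix.star_eq_conjTranspose, hA, Matrix.diagonal_conjTranspose]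
    congr 1
    ext i
    simp
  set s : Finset ℝ := (Matrix.finite_real_spectrum (A := A)).toFinset ∪ Finset.univ.image d with hs'
  set g := Lagrange.interpolate s id f with hg
  have hgf : ∀ x ∈ s, g.eval x = f x := fun x hx =>
    Lagrange.eval_interpolate_at_node f (Set.injOn_id _) hx
  have h1 : cfc f A = cfc g.eval A := cfc_congr fun x hx => (hgf x (by simp [hs', hx])).symm
  rw [h1, cfc_polynomial g A hs]
  have h2 : Polynomial.aeval A g
      = diagonalAlgHom (R := ℝ) (Polynomial.aeval (fun i => (d i : ℂ)) g) := by
    rw [← Polynomial.aeval_algHom_apply]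
    rfl
  rw [h2, diagonalAlgHom_apply]
  congr 1
  ext i
  rw [← hgf (d i) (by simp [hs'])]
  refine Eq.trans ?_ (Polynomial.aeval_algebraMap_apply_eq_algebraMap_eval (A := ℂ) (d i) g)
  exact (Polynomial.aeval_algHom_apply (Pi.evalAlgHom ℝ (fun _ : n => ℂ) i) _ g).symm

/-- The vector with value `a` at `i`, `b` at `j` and `0` elsewhere (for `i ≠ j`). -/
def twoPoint (i j : n) (a b : ℝ) : n → ℝ := fun k => if k = i then a else if k = j then b else 0

theorem sum_comp_twoPoint {i j : n} (hij : i ≠ j) (F : ℝ → ℝ → ℝ) (hF : F 0 0 = 0) (a b c d : ℝ) :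
    ∑ k, F (twoPoint i j a b k) (twoPoint i j c d k) = F a c + F b d := by
  rw [← Finset.sum_subset (Finset.subset_univ {i, j}), Finset.sum_pair hij]
  · simp [twoPoint, hij.symm]
  · intro k _ hk
    simp only [Finset.mem_insert, Finset.mem_singleton, not_or] at hk
    simp [twoPoint, hk.1, hk.2, hF]

theorem trace_diagonal_re (d : n → ℝ) :
    (diagonal (fun k => (d k : ℂ))).trace.re = ∑ k, d k := by
  simp [Matrix.trace_diagonal]

omit [Fintype n] in
theorem posSemidef_diagonal {d : n → ℝ} (hd : ∀ k, 0 ≤ d k) :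
    (diagonal (fun k => (d k : ℂ)) : Matrix n n ℂ).PosSemidef :=
  Matrix.PosSemidef.diagonal fun k => by simpa using hd k

omit [Fintype n] in
theorem diagonal_sub_diagonal_ofReal (d e : n → ℝ) :
    diagonal (fun k => (d k : ℂ)) - diagonal (fun k => (e k : ℂ))
      = (diagonal (fun k => ((d k - e k : ℝ) : ℂ)) : Matrix n n ℂ) := by
  rw [Matrix.diagonal_sub]
  simp

theorem diagonal_mul_diagonal_ofReal (d e : n → ℝ) :
    diagonal (fun k => (d k : ℂ)) * diagonal (fun k => (e k : ℂ))
      = (diagonal (fun k => ((d k * e k : ℝ) : ℂ)) : Matrix n n ℂ) := by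
  rw [Matrix.diagonal_mul_diagonal]
  simp

/-- The third-order Taylor bound behind sharpness. -/
theorem binary_entropy_bound {x : ℝ} (hx : 0 < x) (hx' : x ≤ 1 / 2) :
    (1 + x) * Real.log (1 + x) + (1 - x) * Real.log (1 - x) ≤ x ^ 2 + 4 * x ^ 3 := by
  have hxs : |x| = x := abs_of_pos hx
  have hrem : x ^ 3 / (1 - x) ≤ 2 * x ^ 3 := by
    rw [div_le_iff₀ (by linarith)]
    nlinarith [pow_pos hx 3]
  have h1 := (le_abs_self _).trans
    (Real.abs_log_sub_add_sum_range_le (x := x) (by rw [hxs]; linarith) 2)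
  have h2 := (le_abs_self _).trans
    (Real.abs_log_sub_add_sum_range_le (x := -x) (by rw [abs_neg, hxs]; linarith) 2)
  simp only [Finset.sum_range_succ, Finset.sum_range_zero, abs_neg, hxs] at h1 h2
  norm_num at h1 h2
  have l1 : Real.log (1 - x) ≤ -x - x ^ 2 / 2 + 2 * x ^ 3 := by linarith
  have l2 : Real.log (1 + x) ≤ x - x ^ 2 / 2 + 2 * x ^ 3 := by linarith
  have m1 := mul_le_mul_of_nonneg_left l1 (by linarith : (0 : ℝ) ≤ 1 - x)
  have m2 := mul_le_mul_of_nonneg_left l2 (by linarith : (0 : ℝ) ≤ 1 + x)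
  linarith

theorem exists_near_equality [Nontrivial n] {c : ℝ} (hc : 1 < c) :
    ∃ P Q : Matrix n n ℂ, P.PosSemidef ∧ Q.PosSemidef ∧ P.trace = 1 ∧ Q.trace = 1 ∧ P ≠ Q ∧
      relEntropy P Q - ((P.trace.re : ℝ) : EReal) + ((Q.trace.re : ℝ) : EReal) <
        ((c * (blockConst P Q / 4 * traceNorm (P - Q) ^ 2) : ℝ) : EReal) := by
  obtain ⟨i, j, hij⟩ := exists_pair_ne n
  set x : ℝ := min (1 / 2) ((c - 1) / 8) with hxdef
  have hx : 0 < x := lt_min (by norm_num) (by linarith)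
  have hx1 : x ≤ 1 / 2 := min_le_left _ _
  have hx2 : x ≤ (c - 1) / 8 := min_le_right _ _
  set d : n → ℝ := twoPoint i j ((1 + x) / 2) ((1 - x) / 2) with hd
  set e : n → ℝ := twoPoint i j (1 / 2) (1 / 2) with he
  set P : Matrix n n ℂ := diagonal (fun k => (d k : ℂ)) with hPdef
  set Q : Matrix n n ℂ := diagonal (fun k => (e k : ℂ)) with hQdef
  have hP : P.PosSemidef := posSemidef_diagonal fun k => by
    simp only [hd, twoPoint]; split_ifs <;> linarith
  have hQ : Q.PosSemidef := posSemidef_diagonal fun k => by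
    simp only [he, twoPoint]; split_ifs <;> norm_num
  have hsum : ∀ F : ℝ → ℝ → ℝ, F 0 0 = 0 →
      ∑ k, F (d k) (e k) = F ((1 + x) / 2) (1 / 2) + F ((1 - x) / 2) (1 / 2) :=
    fun F hF => sum_comp_twoPoint hij F hF _ _ _ _
  have tP : P.trace.re = 1 := by
    rw [hPdef, trace_diagonal_re, hsum (fun a _ => a) rfl]; ring
  have tQ : Q.trace.re = 1 := by
    rw [hQdef, trace_diagonal_re, hsum (fun _ b => b) rfl]; ring
  have tr1 : ∀ {R : Matrix n n ℂ}, R.PosSemidef → R.trace.re = 1 → R.trace = 1 := fun hR h =>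
    Complex.ext h (Complex.le_def.1 hR.trace_nonneg).2.symm
  -- The indicator of the positive part of `P - Q`, which is the point `i`.
  set χ : ℝ → ℝ := Set.indicator (Set.Ioi (0 : ℝ)) (fun _ => (1 : ℝ)) with hχ
  have χ1 : χ ((1 + x) / 2 - 1 / 2) = 1 := by
    simp only [hχ]
    exact Set.indicator_of_mem (Set.mem_Ioi.2 (by linarith)) _
  have χ2 : χ ((1 - x) / 2 - 1 / 2) = 0 := by
    simp only [hχ]
    exact Set.indicator_of_notMem (by simp only [Set.mem_Ioi, not_lt]; linarith) _
  have ePi : posProj (P - Q) = diagonal (fun k => ((χ (d k - e k) : ℝ) : ℂ)) := by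
    rw [posProj, hPdef, hQdef, diagonal_sub_diagonal_ofReal, cfc_diagonal]
  have tPiP : (posProj (P - Q) * P).trace.re = (1 + x) / 2 := by
    rw [ePi, hPdef, diagonal_mul_diagonal_ofReal, trace_diagonal_re,
      hsum (fun a b => χ (a - b) * a) (by simp), χ1, χ2]
    ring
  have tPiQ : (posProj (P - Q) * Q).trace.re = 1 / 2 := by
    rw [ePi, hQdef, diagonal_mul_diagonal_ofReal, trace_diagonal_re,
      hsum (fun a b => χ (a - b) * b) (by simp), χ1, χ2]
    ring
  have hC : blockConst P Q = ((1 + x) / 2)⁻¹ := by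
    rw [blockConst, tPiP, tPiQ, tP, tQ]
    congr 1
    rw [max_eq_left (by linarith : (1 : ℝ) / 2 ≤ (1 + x) / 2)]
    exact max_eq_left (max_le (by linarith) (by linarith))
  have hN : traceNorm (P - Q) = x := by
    rw [traceNorm_eq_trace (hP.1.sub hQ.1), Matrix.trace_mul_comm, Matrix.mul_sub,
      Matrix.trace_sub, Matrix.trace_sub, Complex.sub_re, Complex.sub_re, tPiP, tPiQ, tP, tQ]
    ring
  have hrange : LinearMap.range P.mulVecLin ≤ LinearMap.range Q.mulVecLin := by
    -- `P = Q (2 P)`, because `Q` is half the projector onto the two chosen coordinates.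
    have hPQ : P = Q * ((2 : ℂ) • P) := by
      rw [Matrix.mul_smul, hPdef, hQdef, Matrix.diagonal_mul_diagonal, ← Matrix.diagonal_smul]
      congr 1
      ext k
      simp only [hd, he, twoPoint, Pi.smul_apply, smul_eq_mul]
      split_ifs <;> simp
    rw [hPQ, Matrix.mulVecLin_mul]
    exact LinearMap.range_comp_le_range _ _
  have hD : (P * cfc Real.log P - P * cfc Real.log Q).trace.re
      = ((1 + x) * Real.log (1 + x) + (1 - x) * Real.log (1 - x)) / 2 := by
    have : P * cfc Real.log P - P * cfc Real.log Q
        = diagonal (fun k => ((d k * Real.log (d k) - d k * Real.log (e k) : ℝ) : ℂ)) := by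
      rw [hPdef, hQdef, cfc_diagonal, cfc_diagonal, diagonal_mul_diagonal_ofReal,
        diagonal_mul_diagonal_ofReal, diagonal_sub_diagonal_ofReal]
    rw [this, trace_diagonal_re, hsum (fun a b => a * Real.log a - a * Real.log b) (by simp)]
    rw [Real.log_div (x := 1 + x) (by linarith) two_ne_zero,
      Real.log_div (x := 1 - x) (by linarith) two_ne_zero,
      Real.log_div one_ne_zero two_ne_zero, Real.log_one]
    ring
  refine ⟨P, Q, hP, hQ, tr1 hP tP, tr1 hQ tQ, ?_, ?_⟩
  · intro h
    rw [h, sub_self] at hN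
    simp [traceNorm] at hN
    linarith
  · rw [relEntropy, if_pos hrange, hD, hC, hN, tP, tQ]
    have hb := binary_entropy_bound hx hx1
    have hmain : ((1 + x) * Real.log (1 + x) + (1 - x) * Real.log (1 - x)) / 2 - 1 + 1
        < c * (((1 + x) / 2)⁻¹ / 4 * x ^ 2) := by
      have e : c * (((1 + x) / 2)⁻¹ / 4 * x ^ 2) = c * x ^ 2 / (2 * (1 + x)) := by
        field_simp
        ring
      rw [e, lt_div_iff₀ (by linarith)]
      -- `(1 + 4 x) (1 + x) ≤ 1 + 7 x < c`.
      have hlt : (1 + 4 * x) * (1 + x) < c := by nlinarith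
      have h3 := mul_lt_mul_of_pos_left hlt (pow_pos hx 2)
      nlinarith
    exact_mod_cast hmain

end

end GenPinsker

theorem mainTheorem2 {n : Type*} [Fintype n] [DecidableEq n] :
    (∀ P Q : Matrix n n ℂ, P.PosSemidef → Q.PosSemidef →
      (((1 / 4 * GenPinsker.traceNorm (P - Q) ^ 2 : ℝ) : EReal) ≤
        ((max P.trace.re Q.trace.re : ℝ) : EReal) *
          (GenPinsker.relEntropy P Q - (((P - Q).trace.re : ℝ) : EReal))) ∧
      (((GenPinsker.blockConst P Q / 4 * GenPinsker.traceNorm (P - Q) ^ 2 : ℝ) : EReal) ≤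
        GenPinsker.relEntropy P Q - ((P.trace.re : ℝ) : EReal) + ((Q.trace.re : ℝ) : EReal)) ∧
      (GenPinsker.traceConst P Q / 4 * GenPinsker.traceNorm (P - Q) ^ 2 ≤
        GenPinsker.blockConst P Q / 4 * GenPinsker.traceNorm (P - Q) ^ 2)) ∧
    (Nontrivial n → ∀ c : ℝ, 1 < c →
      ∃ P Q : Matrix n n ℂ, P.PosSemidef ∧ Q.PosSemidef ∧ P.trace = 1 ∧ Q.trace = 1 ∧ P ≠ Q ∧
        GenPinsker.relEntropy P Q - ((P.trace.re : ℝ) : EReal) + ((Q.trace.re : ℝ) : EReal) <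
          ((c * (GenPinsker.blockConst P Q / 4 * GenPinsker.traceNorm (P - Q) ^ 2) : ℝ) :
            EReal)) :=
  ⟨fun _ _ hP hQ => ⟨GenPinsker.traceNorm_sq_le hP hQ, GenPinsker.blockConst_bound_ereal hP hQ,
    GenPinsker.traceConst_bound_le hP hQ⟩, fun _ _ hc => GenPinsker.exists_near_equality hc⟩
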